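/- Let $K,n\ge 1$ and $d>K$ be integers, let $\lambda_{W_2},\lambda_{W_1},\lambda_{H_1}>0$, and let $Y=I_K\otimes \mathbf 1_n^\top\in\mathbb R^{K\times Kn}$. Let $(W_2^*,W_1^*,H_1^*)$ be a global minimizer of $$\frac{1}{2Kn}\|W_2W_1H_1-Y\|_F^2+\frac{\lambda_{W_2}}{2}\|W_2\|_F^2+\frac{\lambda_{W_1}}{2}\|W_1\|_F^2+\frac{\lambda_{H_1}}{2}\|H_1\|_F^2$$ over $W_2\in\mathbb R^{K\times d}$, $W_1\in\mathbb R^{d\times d}$, $H_1\in\mathbb R^{d\times Kn}$. Write $A\propto B$ if $A=cB$ for some scalar $c>0$. Then both levels of features collapse within classes and the weights are aligned with them: there are $\overline H_1,\overline H_2\in\mathbb R^{d\times K}$ such that $H_1^*=\overline H_1\otimes\mathbf 1_n^\top$, $W_1^*H_1^*=\overline H_2\otimes\mathbf 1_n^\top$, $(W_2^*W_1^*)^\top\propto\overline H_1$, $W_2^{*\top}\propto\overline H_2$, and $$(W_2^*W_1^*)\overline H_1\propto\overline H_1^\top\overline H_1\propto(W_2^*W_1^*)(W_2^*W_1^*)^\top,\qquad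 W_2^*\overline H_2\propto\overline H_2^\top\overline H_2\propto W_2^*W_2^{*\top}.$$ If, moreover, $(W_2^*,W_1^*,H_1^*)\ne(0,0,0)$ and, in case $K\ge2$, the zero triple $(0,0,0)$ is not itself a global minimizer, then all six of these matrices are $\propto I_K$; that is, $\overline H_1$ and $\overline H_2$ are orthogonal $d\times K$ frames, and $(W_2^*W_1^*)^\top$ and $W_2^{*\top}$ are orthogonal $d\times K$ matrices (columns pairwise orthogonal, of equal positive norm). -/

import Mathlib

noncomputable section

namespace ExtendedUFM

/-- Squared Frobenius norm of a real matrix. -/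
def frobSq {ι κ : Type*} [Fintype ι] [Fintype κ] (A : Matrix ι κ ℝ) : ℝ :=
  ∑ i, ∑ j, A i j ^ 2

/-- `repeatCols n A` is the matrix `A ⊗ 1ₙᵀ`: every column of `A` is repeated `n` times.
The columns of the result are indexed by pairs (class `k`, sample `i` of that class). -/
def repeatCols {d K : ℕ} (n : ℕ) (A : Matrix (Fin d) (Fin K) ℝ) :
    Matrix (Fin d) (Fin K × Fin n) ℝ :=
  Matrix.of fun r c => A r c.1

/-- The one-hot label matrix `Y = I_K ⊗ 1ₙᵀ`. -/
def oneHot (K n : ℕ) : Matrix (Fin K) (Fin K × Fin n) ℝ :=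
  repeatCols n (1 : Matrix (Fin K) (Fin K) ℝ)

/-- The regularized squared loss of the linear unconstrained features model with two layers of
weights; the arguments `a₂ a₁ b` are the regularization parameters of `W₂`, `W₁`, `H₁`. -/
def objective {K n d : ℕ} (a₂ a₁ b : ℝ) (W₂ : Matrix (Fin K) (Fin d) ℝ)
    (W₁ : Matrix (Fin d) (Fin d) ℝ) (H₁ : Matrix (Fin d) (Fin K × Fin n) ℝ) : ℝ :=
  1 / (2 * (K : ℝ) * (n : ℝ)) * frobSq (W₂ * W₁ * H₁ - oneHot K n)
    + a₂ / 2 * frobSq W₂ + a₁ / 2 * frobSq W₁ + b / 2 * frobSq H₁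

/-- `(W₂, W₁, H₁)` attains the global minimum of the objective. -/
def IsGlobalMinimizer {K n d : ℕ} (a₂ a₁ b : ℝ) (W₂ : Matrix (Fin K) (Fin d) ℝ)
    (W₁ : Matrix (Fin d) (Fin d) ℝ) (H₁ : Matrix (Fin d) (Fin K × Fin n) ℝ) : Prop :=
  ∀ (V₂ : Matrix (Fin K) (Fin d) ℝ) (V₁ : Matrix (Fin d) (Fin d) ℝ)
    (G₁ : Matrix (Fin d) (Fin K × Fin n) ℝ),
    objective a₂ a₁ b W₂ W₁ H₁ ≤ objective a₂ a₁ b V₂ V₁ G₁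

/-- `A ∝ B`: the matrices are equal up to a positive scalar factor. -/
def Proportional {ι κ : Type*} (A B : Matrix ι κ ℝ) : Prop :=
  ∃ c : ℝ, 0 < c ∧ A = c • B

end ExtendedUFM

end

open Matrix ExtendedUFM

/-! Minimality in each block separately gives a normal equation. The one for `H₁` is a strictly
convex ridge problem with class-constant labels, so its solution repeats columns. Everything is then
governed by the output T = W₂W₁H, which is symmetric: both Gram matrices W₂W₂ᵀ and HᵀH are multiples
of T(1 - T), and `smul_output` is a polynomial equation for T. By `objective_eq` the loss is the
average of φ(t)/2, φ(t) = 1 + t - 2t², over the eigenvalues t of T.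

A nonzero eigenvalue t can be copied to all K directions by a competitor of loss φ(t)/2, and the
zero triple does this for t = 0. So the average of φ is at most each φ(t), hence equals it.
Comparison with zero forces t ≥ 1/2 when t ≠ 0, and there the polynomial equation has only one root
τ. So T² = τT, from which `aligned` derives all the proportionalities. A zero eigenvalue beside a
nonzero one would mean a tie with the zero triple; otherwise T = τ·1. -/

namespace ExtendedUFM

/-! ### Frobenius norm and normal equations -/

section Frobenius

variable {ι κ μ ν : Type*} [Fintype ι] [Fintype κ] [Fintype μ] [Fintype ν]

lemma frobSq_eq_trace_transpose_mul (A : Matrix ι κ ℝ) : frobSq A = (Aᵀ * A).trace := by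
  simp only [frobSq, trace, diag_apply, Matrix.mul_apply, transpose_apply]
  rw [Finset.sum_comm]
  simp only [sq]

lemma frobSq_eq_trace_mul_transpose (A : Matrix ι κ ℝ) : frobSq A = (A * Aᵀ).trace := by
  rw [frobSq_eq_trace_transpose_mul, trace_mul_comm]

lemma frobSq_eq_zero {A : Matrix ι κ ℝ} (h : frobSq A = 0) : A = 0 := by
  rw [frobSq_eq_trace_transpose_mul, ← conjTranspose_eq_transpose_of_trivial,
    trace_conjTranspose_mul_self_eq_zero_iff] at h
  exact h

lemma frobSq_add_smul (A B : Matrix ι κ ℝ) (t : ℝ) :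
    frobSq (A + t • B) = frobSq A + 2 * t * (Aᵀ * B).trace + t ^ 2 * frobSq B := by
  have h : (Bᵀ * A).trace = (Aᵀ * B).trace := by
    rw [← trace_transpose, transpose_mul, transpose_transpose]
  simp only [frobSq_eq_trace_transpose_mul, transpose_add, transpose_smul, Matrix.add_mul, Matrix.mul_add,
    Matrix.smul_mul, Matrix.mul_smul, trace_add, trace_smul, smul_eq_mul, h]
  ring

lemma frobSq_smul (c : ℝ) (A : Matrix ι κ ℝ) : frobSq (c • A) = c ^ 2 * frobSq A := by
  simp only [frobSq, Matrix.smul_apply, smul_eq_mul, mul_pow, Finset.mul_sum]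

/-- First-order condition at t = 0; the trial point -l / (1 + |c|) is small enough for the linear
term to win whatever the sign of c. -/
lemma linear_coeff_eq_zero {l c : ℝ} (h : ∀ t : ℝ, 0 ≤ t * l + t ^ 2 * c) : l = 0 := by
  by_contra hl
  have hp : 0 < 1 + |c| := by positivity
  have h1 := h (-l / (1 + |c|))
  have h2 : -l / (1 + |c|) * l + (-l / (1 + |c|)) ^ 2 * c
      = l ^ 2 / (1 + |c|) ^ 2 * (c - (1 + |c|)) := by
    field_simp
    ring
  have h3 : 0 < l ^ 2 / (1 + |c|) ^ 2 := by positivity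
  rw [h2] at h1
  nlinarith [le_abs_self c]

/-- The normal equation of a ridge regression problem with a two-sided linear map. -/
lemma normal_equation (L : Matrix ι μ ℝ) (R : Matrix ν κ ℝ) (Y : Matrix ι κ ℝ)
    (W : Matrix μ ν ℝ) (c a : ℝ)
    (h : ∀ V : Matrix μ ν ℝ, c / 2 * frobSq (L * W * R - Y) + a / 2 * frobSq W
      ≤ c / 2 * frobSq (L * V * R - Y) + a / 2 * frobSq V) :
    c • (Lᵀ * (L * W * R - Y) * Rᵀ) + a • W = 0 := by
  set G := c • (Lᵀ * (L * W * R - Y) * Rᵀ) + a • W with hG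
  apply frobSq_eq_zero
  -- The derivative in the direction of the gradient `G` is the squared norm of `G`.
  have key : c * ((L * W * R - Y)ᵀ * (L * G * R)).trace + a * (Wᵀ * G).trace = frobSq G := by
    rw [frobSq_eq_trace_transpose_mul]
    conv_rhs =>
      enter [1, 1]
      rw [hG]
    simp only [transpose_add, transpose_smul, Matrix.add_mul, Matrix.smul_mul, trace_add, trace_smul,
      smul_eq_mul, transpose_mul, transpose_transpose]
    congr 2
    rw [← Matrix.mul_assoc, trace_mul_comm]
    simp only [Matrix.mul_assoc]
  refine linear_coeff_eq_zero (c := c / 2 * frobSq (L * G * R) + a / 2 * frobSq G) fun t => ?_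
  have h1 := h (W + t • G)
  have h2 : L * (W + t • G) * R - Y = (L * W * R - Y) + t • (L * G * R) := by
    simp only [Matrix.mul_add, Matrix.add_mul, Matrix.mul_smul, Matrix.smul_mul]
    abel
  rw [h2, frobSq_add_smul, frobSq_add_smul] at h1
  have h3 := congrArg (fun x => t * x) key
  linarith

lemma mul_eq_zero_of_transpose_mul_self {ρ : Type*} {A : Matrix ι κ ℝ} {B : Matrix κ ρ ℝ}
    (h : Aᵀ * A * B = 0) : A * B = 0 := by
  rw [← conjTranspose_eq_transpose_of_trivial] at h
  exact (conjTranspose_mul_self_mul_eq_zero A B).1 h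

end Frobenius

/-! ### Class-constant matrices -/

section RepeatCols

variable {d e K : ℕ} (n : ℕ)

lemma mul_repeatCols (X : Matrix (Fin e) (Fin d) ℝ) (A : Matrix (Fin d) (Fin K) ℝ) :
    X * repeatCols n A = repeatCols n (X * A) := by
  ext i j
  simp [repeatCols, Matrix.mul_apply]

lemma repeatCols_sub (A B : Matrix (Fin d) (Fin K) ℝ) :
    repeatCols n A - repeatCols n B = repeatCols n (A - B) := rfl

lemma repeatCols_mul_transpose (A : Matrix (Fin d) (Fin K) ℝ) (B : Matrix (Fin e) (Fin K) ℝ) :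
    repeatCols n A * (repeatCols n B)ᵀ = (n : ℝ) • (A * Bᵀ) := by
  ext i j
  simp [repeatCols, Matrix.mul_apply, Fintype.sum_prod_type, Finset.mul_sum]

lemma frobSq_repeatCols (A : Matrix (Fin d) (Fin K) ℝ) :
    frobSq (repeatCols n A) = n * frobSq A := by
  rw [frobSq_eq_trace_mul_transpose, repeatCols_mul_transpose, trace_smul, smul_eq_mul,
    frobSq_eq_trace_mul_transpose]

end RepeatCols

section Proportionality

variable {ι κ : Type*}

lemma Proportional.trans {A B C : Matrix ι κ ℝ} (h : Proportional A B) (h' : Proportional B C) :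
    Proportional A C := by
  obtain ⟨c, hc, rfl⟩ := h
  obtain ⟨c', hc', rfl⟩ := h'
  exact ⟨c * c', mul_pos hc hc', smul_smul _ _ _⟩

lemma Proportional.symm {A B : Matrix ι κ ℝ} (h : Proportional A B) : Proportional B A := by
  obtain ⟨c, hc, rfl⟩ := h
  exact ⟨c⁻¹, inv_pos.2 hc, by rw [smul_smul, inv_mul_cancel₀ hc.ne', one_smul]⟩

end Proportionality

/-! ### Stationarity and within-class collapse -/

/-- The stationarity equations of a triple whose features are collapsed to the class means `H`,
with `T = W₂ W₁ H` the matrix of outputs. -/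
structure Stationary {K d : ℕ} (α β γ : ℝ) (W₂ : Matrix (Fin K) (Fin d) ℝ)
    (W₁ : Matrix (Fin d) (Fin d) ℝ) (H : Matrix (Fin d) (Fin K) ℝ)
    (T : Matrix (Fin K) (Fin K) ℝ) : Prop where
  output : T = W₂ * W₁ * H
  eq_W₂ : α • W₂ = (1 - T) * Hᵀ * W₁ᵀ
  eq_W₁ : β • W₁ = W₂ᵀ * (1 - T) * Hᵀ
  eq_H : γ • H = (W₂ * W₁)ᵀ * (1 - T)
  symm : Tᵀ = T

lemma IsGlobalMinimizer.exists_stationary {K n d : ℕ} (hK : 1 ≤ K) (hn : 1 ≤ n)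
    {a₂ a₁ b : ℝ} (hb : 0 < b) {W₂ : Matrix (Fin K) (Fin d) ℝ}
    {W₁ : Matrix (Fin d) (Fin d) ℝ} {H₁ : Matrix (Fin d) (Fin K × Fin n) ℝ}
    (hmin : IsGlobalMinimizer a₂ a₁ b W₂ W₁ H₁) :
    ∃ H T, H₁ = repeatCols n H ∧ Stationary (K * a₂) (K * a₁) (K * n * b) W₂ W₁ H T := by
  have hK' : (0 : ℝ) < K := by exact_mod_cast hK
  have hn' : (0 : ℝ) < n := by exact_mod_cast hn
  have hc : 1 / (2 * (K : ℝ) * (n : ℝ)) = 1 / (K * n) / 2 := by field_simp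
  have e₂ := normal_equation (1 : Matrix (Fin K) (Fin K) ℝ) (W₁ * H₁) (oneHot K n) W₂
    (1 / (K * n)) a₂ (fun V => by
      have := hmin V W₁ H₁
      simp only [objective, hc] at this
      simp only [Matrix.one_mul, ← Matrix.mul_assoc]
      linarith)
  have e₁ := normal_equation W₂ H₁ (oneHot K n) W₁ (1 / (K * n)) a₁ (fun V => by
      have := hmin W₂ V H₁
      simp only [objective, hc] at this
      linarith)
  have e₃ := normal_equation (W₂ * W₁) (1 : Matrix (Fin K × Fin n) (Fin K × Fin n) ℝ)
    (oneHot K n) H₁ (1 / (K * n)) b (fun V => by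
      have := hmin W₂ W₁ V
      simp only [objective, hc] at this
      simp only [Matrix.mul_one]
      linarith)
  simp only [Matrix.one_mul, Matrix.mul_one, transpose_one, ← Matrix.mul_assoc] at e₂ e₁ e₃
  set M := W₂ * W₁
  have hpos : 0 < (K : ℝ) * n * b := by positivity
  set A : Matrix (Fin d) (Fin d) ℝ := Mᵀ * M + (K * n * b : ℝ) • 1 with hA
  -- The penalty on `H₁` makes its normal equation uniquely solvable.
  have hdet : IsUnit A.det := by
    have : A.PosDef := by
      refine PosDef.posSemidef_add ?_ ?_
      · rw [← conjTranspose_eq_transpose_of_trivial]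
        exact posSemidef_conjTranspose_mul_self M
      · exact PosDef.one.smul hpos
    exact this.det_pos.ne'.isUnit
  have hH : H₁ = repeatCols n (A⁻¹ * Mᵀ) := by
    have h1 : A * H₁ = Mᵀ * oneHot K n := by
      have h2 : (K * n : ℝ) • ((1 / (K * n) : ℝ) • (Mᵀ * (M * H₁ - oneHot K n)) + b • H₁) = 0 := by
        rw [e₃, smul_zero]
      rw [smul_add, smul_smul, smul_smul, mul_one_div_cancel (by positivity), one_smul,
        Matrix.mul_sub, ← Matrix.mul_assoc] at h2
      rw [hA, Matrix.add_mul, Matrix.smul_mul, Matrix.one_mul]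
      rw [sub_add_eq_add_sub, sub_eq_zero] at h2
      exact h2
    rw [← mul_repeatCols n A⁻¹, show repeatCols n Mᵀ = Mᵀ * oneHot K n by
      rw [oneHot, mul_repeatCols, Matrix.mul_one], ← h1, nonsing_inv_mul_cancel_left _ _ hdet]
  obtain ⟨H, rfl⟩ : ∃ H, H₁ = repeatCols n H := ⟨_, hH⟩
  have hres : M * repeatCols n H - oneHot K n = repeatCols n (M * H - 1) := by
    rw [mul_repeatCols, oneHot, repeatCols_sub]
  have eq_H : (K * n * b : ℝ) • H = Mᵀ * (1 - M * H) := by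
    rw [hres, mul_repeatCols] at e₃
    ext i j
    -- All samples of a class agree, so sample 0 suffices; it exists because n ≥ 1.
    have h1 := congrFun (congrFun e₃ i) (j, ⟨0, hn⟩)
    have h2 : Mᵀ * (1 - M * H) = -(Mᵀ * (M * H - 1)) := by
      rw [← Matrix.mul_neg, neg_sub]
    rw [h2]
    simp only [repeatCols, Matrix.add_apply, Matrix.smul_apply, of_apply, Matrix.zero_apply, Matrix.neg_apply,
      smul_eq_mul] at h1 ⊢
    field_simp at h1
    linarith
  have hres' : 1 - M * H = -(M * H - 1) := by rw [neg_sub]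
  have hKn : (1 / (K * n) : ℝ) * n = 1 / K := by field_simp
  refine ⟨H, M * H, rfl, rfl, ?_, ?_, eq_H, ?_⟩
  · rw [hres, transpose_mul, ← Matrix.mul_assoc, repeatCols_mul_transpose, Matrix.smul_mul, smul_smul,
      hKn] at e₂
    rw [hres', Matrix.neg_mul, Matrix.neg_mul, eq_neg_iff_add_eq_zero, add_comm]
    have h2 : (K : ℝ) • ((1 / K : ℝ) • ((M * H - 1) * Hᵀ * W₁ᵀ) + a₂ • W₂) = 0 := by
      rw [e₂, smul_zero]
    rwa [smul_add, smul_smul, smul_smul, mul_one_div_cancel hK'.ne', one_smul] at h2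
  · rw [hres, Matrix.mul_assoc, repeatCols_mul_transpose, Matrix.mul_smul, smul_smul, hKn] at e₁
    rw [hres', Matrix.mul_neg, Matrix.neg_mul, eq_neg_iff_add_eq_zero, add_comm, Matrix.mul_assoc]
    have h2 : (K : ℝ) • ((1 / K : ℝ) • (W₂ᵀ * ((M * H - 1) * Hᵀ)) + a₁ • W₁) = 0 := by
      rw [e₁, smul_zero]
    rwa [smul_add, smul_smul, smul_smul, mul_one_div_cancel hK'.ne', one_smul] at h2
  -- Symmetry of T = MH: expanding γTᵀT from either factor, by γT = MMᵀ(1 - T) or its transpose,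
  -- shows TᵀMMᵀ = MMᵀT, and then γTᵀ = γT.
  · have h1 : (K * n * b : ℝ) • (M * H) = M * Mᵀ * (1 - M * H) := by
      rw [← Matrix.mul_smul, eq_H, ← Matrix.mul_assoc]
    have h2 : (K * n * b : ℝ) • (M * H)ᵀ = (1 - (M * H)ᵀ) * (M * Mᵀ) := by
      rw [← transpose_smul, h1, transpose_mul, transpose_mul, transpose_transpose,
        transpose_sub, transpose_one]
    have h3 : (K * n * b : ℝ) • ((M * H)ᵀ * (M * H))
        = (M * H)ᵀ * (M * Mᵀ) - (M * H)ᵀ * (M * Mᵀ) * (M * H) := by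
      rw [← Matrix.mul_smul, h1, Matrix.mul_sub (M * Mᵀ), Matrix.mul_one, Matrix.mul_sub,
        ← Matrix.mul_assoc _ (M * Mᵀ)]
    have h4 : (K * n * b : ℝ) • ((M * H)ᵀ * (M * H))
        = (M * Mᵀ) * (M * H) - (M * H)ᵀ * (M * Mᵀ) * (M * H) := by
      rw [← Matrix.smul_mul, h2, Matrix.sub_mul, Matrix.one_mul, Matrix.sub_mul]
    have h5 : (M * H)ᵀ * (M * Mᵀ) = (M * Mᵀ) * (M * H) := by
      rw [h3] at h4
      exact sub_left_injective h4
    have h6 : (K * n * b : ℝ) • (M * H)ᵀ = (K * n * b : ℝ) • (M * H) := by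
      rw [h2, h1, Matrix.sub_mul, Matrix.one_mul, h5, Matrix.mul_sub, Matrix.mul_one]
    exact smul_right_injective _ hpos.ne' h6

/-! ### Algebraic consequences of stationarity -/

namespace Stationary

variable {K d : ℕ} {α β γ : ℝ} {W₂ : Matrix (Fin K) (Fin d) ℝ}
  {W₁ : Matrix (Fin d) (Fin d) ℝ} {H : Matrix (Fin d) (Fin K) ℝ}
  {T : Matrix (Fin K) (Fin K) ℝ}

lemma gram_W₂ (h : Stationary α β γ W₂ W₁ H T) : α • (W₂ * W₂ᵀ) = T * (1 - T) := by
  have h1 : Hᵀ * W₁ᵀ * W₂ᵀ = T := by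
    rw [← h.symm, h.output]
    simp only [transpose_mul, Matrix.mul_assoc]
  rw [← Matrix.smul_mul, h.eq_W₂, Matrix.mul_assoc, Matrix.mul_assoc, ← Matrix.mul_assoc Hᵀ, h1]
  noncomm_ring

lemma gram_H (h : Stationary α β γ W₂ W₁ H T) : γ • (Hᵀ * H) = T * (1 - T) := by
  rw [← Matrix.mul_smul, h.eq_H, ← Matrix.mul_assoc, ← transpose_mul, ← h.output, h.symm]

/-- Both sides equal W₂ᵀ(1 - T)HᵀW₁ᵀ. -/
lemma balance_left (h : Stationary α β γ W₂ W₁ H T) :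
    β • (W₁ * W₁ᵀ) = α • (W₂ᵀ * W₂) := by
  rw [← Matrix.smul_mul, h.eq_W₁, ← Matrix.mul_smul, h.eq_W₂]
  simp only [Matrix.mul_assoc]

lemma balance_right (h : Stationary α β γ W₂ W₁ H T) :
    β • (W₁ᵀ * W₁) = γ • (H * Hᵀ) := by
  have h1 : γ • Hᵀ = (1 - T) * (W₂ * W₁) := by
    rw [← transpose_smul, h.eq_H, transpose_mul, transpose_transpose, transpose_sub,
      transpose_one, h.symm]
  rw [← Matrix.mul_smul H, h1, ← Matrix.smul_mul, ← transpose_smul, h.eq_W₁]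
  simp only [transpose_mul, transpose_sub, transpose_one, transpose_transpose, h.symm,
    Matrix.mul_assoc]

lemma gram_W₂_mul_W₁ (h : Stationary α β γ W₂ W₁ H T) :
    β • (W₂ * W₁ * (W₂ * W₁)ᵀ) = α • (W₂ * W₂ᵀ * (W₂ * W₂ᵀ)) := by
  have h1 : β • (W₂ * W₁ * (W₂ * W₁)ᵀ) = W₂ * (β • (W₁ * W₁ᵀ)) * W₂ᵀ := by
    simp only [transpose_mul, Matrix.mul_assoc, Matrix.mul_smul, Matrix.smul_mul]
  rw [h1, h.balance_left]
  simp only [Matrix.mul_assoc, Matrix.mul_smul, Matrix.smul_mul]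

lemma gram_W₁_mul_H (h : Stationary α β γ W₂ W₁ H T) :
    β • ((W₁ * H)ᵀ * (W₁ * H)) = γ • (Hᵀ * H * (Hᵀ * H)) := by
  have h1 : β • ((W₁ * H)ᵀ * (W₁ * H)) = Hᵀ * (β • (W₁ᵀ * W₁)) * H := by
    simp only [transpose_mul, Matrix.mul_assoc, Matrix.mul_smul, Matrix.smul_mul]
  rw [h1, h.balance_right]
  simp only [Matrix.mul_assoc, Matrix.mul_smul, Matrix.smul_mul]

lemma smul_output (h : Stationary α β γ W₂ W₁ H T) :
    (α * β * γ) • T = T * (1 - T) * (T * (1 - T)) * (1 - T) := by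
  have h1 : γ • T = W₂ * W₁ * (W₂ * W₁)ᵀ * (1 - T) := by
    conv_lhs => rw [h.output]
    rw [← Matrix.mul_smul, h.eq_H, ← Matrix.mul_assoc]
  rw [← smul_smul, h1, ← smul_smul, ← Matrix.smul_mul, h.gram_W₂_mul_W₁, ← h.gram_W₂]
  simp only [Matrix.smul_mul, Matrix.mul_smul]

/-- If the output matrix is a multiple of a projection, features and weights are aligned. -/
lemma aligned (h : Stationary α β γ W₂ W₁ H T) (hα : 0 < α) (hβ : 0 < β) (hγ : 0 < γ)
    {τ : ℝ} (hτ : 0 < τ) (hτ' : τ < 1) (hT : T * T = τ • T) :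
    Proportional (W₂ * W₁)ᵀ H ∧ Proportional W₂ᵀ (W₁ * H) ∧
    Proportional (W₂ * W₁ * H) T ∧ Proportional (Hᵀ * H) T ∧
    Proportional (W₂ * W₁ * (W₂ * W₁)ᵀ) T ∧ Proportional (W₂ * (W₁ * H)) T ∧
    Proportional ((W₁ * H)ᵀ * (W₁ * H)) T ∧ Proportional (W₂ * W₂ᵀ) T := by
  have hτ1 : 0 < 1 - τ := sub_pos.2 hτ'
  have hT1 : T * (1 - T) = (1 - τ) • T := by
    rw [Matrix.mul_sub, hT, Matrix.mul_one, sub_smul, one_smul]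
  have hP : W₂ * W₂ᵀ = ((1 - τ) / α) • T := by
    rw [div_eq_inv_mul, ← smul_smul, ← hT1, ← h.gram_W₂, smul_smul, inv_mul_cancel₀ hα.ne', one_smul]
  have hG : Hᵀ * H = ((1 - τ) / γ) • T := by
    rw [div_eq_inv_mul, ← smul_smul, ← hT1, ← h.gram_H, smul_smul, inv_mul_cancel₀ hγ.ne', one_smul]
  have hQ : W₂ * W₁ * (W₂ * W₁)ᵀ = (α / β * ((1 - τ) / α) ^ 2 * τ) • T := by
    have h1 := congrArg (fun X => β⁻¹ • X) h.gram_W₂_mul_W₁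
    simp only [hP, Matrix.smul_mul, Matrix.mul_smul, hT, smul_smul, inv_mul_cancel₀ hβ.ne', one_smul] at h1
    rw [h1]
    congr 1
    ring
  have hG₂ : (W₁ * H)ᵀ * (W₁ * H) = (γ / β * ((1 - τ) / γ) ^ 2 * τ) • T := by
    have h1 := congrArg (fun X => β⁻¹ • X) h.gram_W₁_mul_H
    simp only [hG, Matrix.smul_mul, Matrix.mul_smul, hT, smul_smul, inv_mul_cancel₀ hβ.ne', one_smul] at h1
    rw [h1]
    congr 1
    ring
  have hT0 : T * (T - τ • 1) = 0 := by
    rw [Matrix.mul_sub, hT, Matrix.mul_smul, Matrix.mul_one, sub_self]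
  -- A matrix and its Gram matrix have the same kernel, and the Gram matrix is a multiple of T.
  have hM0 : (W₂ * W₁)ᵀ * (T - τ • 1) = 0 := by
    apply mul_eq_zero_of_transpose_mul_self
    rw [transpose_transpose, hQ, Matrix.smul_mul, hT0, smul_zero]
  have hH0 : W₁ * H * (T - τ • 1) = 0 := by
    apply mul_eq_zero_of_transpose_mul_self
    rw [hG₂, Matrix.smul_mul, hT0, smul_zero]
  rw [Matrix.mul_sub, Matrix.mul_smul, Matrix.mul_one, sub_eq_zero] at hM0 hH0
  refine ⟨⟨γ / (1 - τ), by positivity, ?_⟩, ⟨(1 - τ) / α, by positivity, ?_⟩,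
    ⟨1, one_pos, by rw [one_smul, h.output]⟩, ⟨_, by positivity, hG⟩, ⟨_, by positivity, hQ⟩,
    ⟨1, one_pos, by rw [one_smul, h.output, Matrix.mul_assoc]⟩, ⟨_, by positivity, hG₂⟩,
    ⟨_, by positivity, hP⟩⟩
  · have h1 : γ • H = (1 - τ) • (W₂ * W₁)ᵀ := by
      rw [h.eq_H, Matrix.mul_sub, hM0, Matrix.mul_one, sub_smul, one_smul]
    rw [div_eq_inv_mul, ← smul_smul, h1, smul_smul, inv_mul_cancel₀ hτ1.ne', one_smul]
  · have h1 : α • W₂ᵀ = (1 - τ) • (W₁ * H) := by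
      rw [← transpose_smul, h.eq_W₂, transpose_mul, transpose_mul, transpose_sub, transpose_one,
        h.symm, transpose_transpose, transpose_transpose, ← Matrix.mul_assoc, Matrix.mul_sub,
        hH0, Matrix.mul_one, sub_smul, one_smul]
    rw [div_eq_inv_mul, ← smul_smul, ← h1, smul_smul, inv_mul_cancel₀ hα.ne', one_smul]

lemma eq_zero_of_output_eq_zero (h : Stationary α β γ W₂ W₁ H T) (hα : 0 < α) (hβ : 0 < β)
    (hγ : 0 < γ) (hT : T = 0) : W₂ = 0 ∧ W₁ = 0 ∧ H = 0 := by
  have h₂ : W₂ = 0 := by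
    apply frobSq_eq_zero
    have h1 := h.gram_W₂
    rw [hT, Matrix.zero_mul, smul_eq_zero_iff_right hα.ne'] at h1
    rw [frobSq_eq_trace_mul_transpose, h1, trace_zero]
  have hβ0 := h.eq_W₁
  have hγ0 := h.eq_H
  rw [h₂, transpose_zero, Matrix.zero_mul, Matrix.zero_mul,
    smul_eq_zero_iff_right hβ.ne'] at hβ0
  rw [h₂, Matrix.zero_mul, transpose_zero, Matrix.zero_mul,
    smul_eq_zero_iff_right hγ.ne'] at hγ0
  exact ⟨h₂, hβ0, hγ0⟩

/-- Each of the three penalties equals tr(T - T²) / (2K), so the loss depends on T alone. -/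
lemma objective_eq {n : ℕ} (hK : 1 ≤ K) (hn : 1 ≤ n) {a₂ a₁ b : ℝ}
    (h : Stationary (K * a₂) (K * a₁) (K * n * b) W₂ W₁ H T) :
    objective a₂ a₁ b W₂ W₁ (repeatCols n H) = 1 / (2 * K) * (1 + T - (2 : ℝ) • (T * T)).trace := by
  have hK' : (0 : ℝ) < K := by exact_mod_cast hK
  have hn' : (0 : ℝ) < n := by exact_mod_cast hn
  have h₂ := congrArg trace h.gram_W₂
  have h₁ := congrArg trace h.balance_left
  have h₀ := congrArg trace h.gram_H
  have hf : frobSq (T - 1) = ((1 : Matrix (Fin K) (Fin K) ℝ) - (2 : ℝ) • T + T * T).trace := by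
    rw [frobSq_eq_trace_mul_transpose, transpose_sub, h.symm, transpose_one]
    congr 1
    rw [two_smul]
    noncomm_ring
  simp only [trace_smul, smul_eq_mul, ← frobSq_eq_trace_mul_transpose,
    ← frobSq_eq_trace_transpose_mul, Matrix.mul_sub, Matrix.mul_one, trace_sub] at h₂ h₁ h₀
  rw [objective, mul_repeatCols, oneHot, repeatCols_sub, ← h.output, frobSq_repeatCols,
    frobSq_repeatCols, hf]
  simp only [trace_sub, trace_add, trace_smul, smul_eq_mul]
  have e₂ : a₂ * frobSq W₂ = (T.trace - (T * T).trace) / K := by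
    rw [← h₂]; field_simp
  have e₁ : a₁ * frobSq W₁ = a₂ * frobSq W₂ := by
    apply mul_left_cancel₀ hK'.ne'; linarith
  have e₀ : b * (n * frobSq H) = (T.trace - (T * T).trace) / K := by
    rw [← h₀]; field_simp
  rw [show a₂ / 2 * frobSq W₂ = (a₂ * frobSq W₂) / 2 by ring,
    show a₁ / 2 * frobSq W₁ = (a₁ * frobSq W₁) / 2 by ring,
    show b / 2 * (n * frobSq H) = (b * (n * frobSq H)) / 2 by ring, e₁, e₂, e₀]
  field_simp
  ring

end Stationary

/-! ### Spectrum of the output matrix -/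

/-- The real spectral theorem in terms of transposes. -/
lemma exists_orthogonal_diagonalization {m : ℕ} {T : Matrix (Fin m) (Fin m) ℝ} (h : Tᵀ = T) :
    ∃ (U : Matrix (Fin m) (Fin m) ℝ) (l : Fin m → ℝ),
      Uᵀ * U = 1 ∧ U * Uᵀ = 1 ∧ Uᵀ * T * U = diagonal l := by
  have hT : T.IsHermitian := by
    rwa [IsHermitian, conjTranspose_eq_transpose_of_trivial]
  refine ⟨hT.eigenvectorUnitary, hT.eigenvalues, ?_, ?_, ?_⟩
  · have := Unitary.coe_star_mul_self hT.eigenvectorUnitary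
    rwa [star_eq_conjTranspose, conjTranspose_eq_transpose_of_trivial] at this
  · have := Unitary.coe_mul_star_self hT.eigenvectorUnitary
    rwa [Unitary.coe_star, star_eq_conjTranspose, conjTranspose_eq_transpose_of_trivial] at this
  · have := hT.conjStarAlgAut_star_eigenvectorUnitary
    rw [Unitary.conjStarAlgAut_apply] at this
    simpa [star_eq_conjTranspose, conjTranspose_eq_transpose_of_trivial] using this

/-- The objective at a triple of multiples of a partial isometry. -/
lemma exists_objective_eq {K n d : ℕ} (hK : 1 ≤ K) (hn : 1 ≤ n) (hd : K ≤ d) (a₂ a₁ b x y z : ℝ) :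
    ∃ (W₂ : Matrix (Fin K) (Fin d) ℝ) (W₁ : Matrix (Fin d) (Fin d) ℝ)
      (H₁ : Matrix (Fin d) (Fin K × Fin n) ℝ),
      objective a₂ a₁ b W₂ W₁ H₁ = 1 / 2 * (x * y * z - 1) ^ 2
        + K * (a₂ * x ^ 2 + a₁ * y ^ 2 + b * n * z ^ 2) / 2 := by
  have hK' : (0 : ℝ) < K := by exact_mod_cast hK
  have hn' : (0 : ℝ) < n := by exact_mod_cast hn
  obtain ⟨E, hE⟩ : ∃ E : Matrix (Fin K) (Fin d) ℝ, E * Eᵀ = 1 := by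
    refine ⟨(1 : Matrix (Fin d) (Fin d) ℝ).submatrix (Fin.castLE hd) id, ?_⟩
    rw [transpose_submatrix, transpose_one, ← submatrix_mul _ _ _ _ _ Function.bijective_id,
      Matrix.mul_one]
    exact submatrix_one _ (Fin.castLE_injective hd)
  have hone : frobSq (1 : Matrix (Fin K) (Fin K) ℝ) = K := by
    rw [frobSq_eq_trace_mul_transpose]; simp
  have hE1 : frobSq E = K := by
    rw [frobSq_eq_trace_mul_transpose, hE]; simp
  have hE2 : frobSq Eᵀ = K := by
    rw [frobSq_eq_trace_transpose_mul, transpose_transpose, hE]; simp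
  have hE3 : frobSq (Eᵀ * E) = K := by
    rw [frobSq_eq_trace_transpose_mul, transpose_mul, transpose_transpose, ← Matrix.mul_assoc,
      Matrix.mul_assoc Eᵀ, hE, Matrix.mul_one, trace_mul_comm, hE]
    simp
  refine ⟨x • E, y • (Eᵀ * E), repeatCols n (z • Eᵀ), ?_⟩
  have hout : x • E * y • (Eᵀ * E) * z • Eᵀ - 1 = (x * y * z - 1) • (1 : Matrix (Fin K) (Fin K) ℝ) := by
    simp only [Matrix.smul_mul, Matrix.mul_smul, ← Matrix.mul_assoc, hE, Matrix.one_mul, smul_smul, sub_smul,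
      one_smul]
    congr 2
    ring
  rw [objective, mul_repeatCols, oneHot, repeatCols_sub, hout, frobSq_repeatCols,
    frobSq_repeatCols, frobSq_smul, frobSq_smul, frobSq_smul, frobSq_smul, hone, hE1, hE2, hE3]
  field_simp
  ring

lemma objective_zero {K n d : ℕ} (hK : 1 ≤ K) (hn : 1 ≤ n) (a₂ a₁ b : ℝ) :
    objective a₂ a₁ b (0 : Matrix (Fin K) (Fin d) ℝ) (0 : Matrix (Fin d) (Fin d) ℝ)
      (0 : Matrix (Fin d) (Fin K × Fin n) ℝ) = 1 / 2 := by
  have hK' : (0 : ℝ) < K := by exact_mod_cast hK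
  have hn' : (0 : ℝ) < n := by exact_mod_cast hn
  have h0 : ∀ {ι κ : Type} [Fintype ι] [Fintype κ], frobSq (0 : Matrix ι κ ℝ) = 0 := by
    intros; simp [frobSq]
  have h1 : frobSq (0 - oneHot K n) = n * K := by
    rw [oneHot, show (0 : Matrix (Fin K) (Fin K × Fin n) ℝ) = repeatCols n 0 from rfl,
      repeatCols_sub, frobSq_repeatCols, zero_sub, frobSq_eq_trace_mul_transpose]
    simp
  rw [objective, Matrix.mul_zero, h1, h0, h0, h0]
  field_simp
  ring

/-- `τ ↦ τ (1 - τ) ^ 3` is injective on `[1/2, 1)`. -/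
lemma eq_of_mul_one_sub_cube_eq {p q : ℝ} (hp : 1 / 2 ≤ p) (hp1 : p < 1) (hq : 1 / 2 ≤ q)
    (hq1 : q < 1) (h : p * (1 - p) ^ 3 = q * (1 - q) ^ 3) : p = q := by
  have key : ∀ {p q : ℝ}, 1 / 2 ≤ p → p < q → q < 1 →
      q * (1 - q) ^ 3 < p * (1 - p) ^ 3 := by
    intro p q hp hpq hq
    have hs : p * (1 - p) ≥ q * (1 - q) := by nlinarith
    have hr : (1 - q) ^ 2 < (1 - p) ^ 2 := by nlinarith
    have hq0 : 0 < q * (1 - q) := mul_pos (by linarith) (by linarith)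
    calc q * (1 - q) ^ 3 = q * (1 - q) * (1 - q) ^ 2 := by ring
      _ < q * (1 - q) * (1 - p) ^ 2 := by gcongr
      _ ≤ p * (1 - p) * (1 - p) ^ 2 := by gcongr
      _ = _ := by ring
  rcases lt_trichotomy p q with hlt | heq | hgt
  · exact absurd h (key hp hlt hq1).ne'
  · exact heq
  · exact absurd h (key hq hgt hp1).ne

/-- The eigenvalues of the output matrix of a global minimizer vanish or are equal to a common
positive value, and they all vanish or all do not unless zero is also a global minimizer. -/
lemma IsGlobalMinimizer.exists_eigenvalue {K n d : ℕ} (hK : 1 ≤ K) (hn : 1 ≤ n) (hd : K ≤ d)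
    {a₂ a₁ b : ℝ} (ha₂ : 0 < a₂) (ha₁ : 0 < a₁) (hb : 0 < b) {W₂ : Matrix (Fin K) (Fin d) ℝ}
    {W₁ : Matrix (Fin d) (Fin d) ℝ} {H : Matrix (Fin d) (Fin K) ℝ}
    {T : Matrix (Fin K) (Fin K) ℝ}
    (hmin : IsGlobalMinimizer a₂ a₁ b W₂ W₁ (repeatCols n H))
    (h : Stationary (K * a₂) (K * a₁) (K * n * b) W₂ W₁ H T) :
    ∃ τ : ℝ, 0 < τ ∧ τ < 1 ∧ T * T = τ • T ∧
      (T ≠ 0 → (K = 1 ∨ ¬ IsGlobalMinimizer a₂ a₁ b (0 : Matrix (Fin K) (Fin d) ℝ)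
        (0 : Matrix (Fin d) (Fin d) ℝ) (0 : Matrix (Fin d) (Fin K × Fin n) ℝ)) → T = τ • 1) := by
  have hK' : (0 : ℝ) < K := by exact_mod_cast hK
  have hn' : (0 : ℝ) < n := by exact_mod_cast hn
  obtain ⟨U, l, hU, hU', hD⟩ := exists_orthogonal_diagonalization h.symm
  set D : Matrix (Fin K) (Fin K) ℝ := diagonal l with hDdef
  have conj : ∀ A B : Matrix (Fin K) (Fin K) ℝ, Uᵀ * (A * B) * U = (Uᵀ * A * U) * (Uᵀ * B * U) := by
    intro A B
    rw [show (Uᵀ * A * U) * (Uᵀ * B * U) = Uᵀ * A * (U * Uᵀ) * B * U by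
      simp only [Matrix.mul_assoc], hU', Matrix.mul_one]
    simp only [Matrix.mul_assoc]
  have conj_inj : ∀ A B : Matrix (Fin K) (Fin K) ℝ, Uᵀ * A * U = Uᵀ * B * U → A = B := by
    intro A B hAB
    have h1 : ∀ A : Matrix (Fin K) (Fin K) ℝ, U * (Uᵀ * A * U) * Uᵀ = A := by
      intro A
      rw [show U * (Uᵀ * A * U) * Uᵀ = (U * Uᵀ) * A * (U * Uᵀ) by
        simp only [Matrix.mul_assoc], hU', Matrix.one_mul, Matrix.mul_one]
    rw [← h1 A, hAB, h1 B]
  have conj_sub : Uᵀ * (1 - T) * U = 1 - D := by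
    rw [Matrix.mul_sub, Matrix.sub_mul, Matrix.mul_one, hU, hD]
  have one_sub : (1 - D) = diagonal fun i => 1 - l i := by
    rw [hDdef, ← diagonal_one, diagonal_sub]
  -- the scalar equation and the bounds satisfied by each eigenvalue
  set g : ℝ := K * a₂ * (K * a₁) * (K * n * b) with hg
  have hg0 : 0 < g := by positivity
  have hcubic : ∀ i, g * l i = (l i * (1 - l i)) ^ 2 * (1 - l i) := by
    intro i
    have h1 := congrArg (fun X => Uᵀ * X * U) h.smul_output
    simp only [conj, conj_sub, Matrix.mul_smul, Matrix.smul_mul, hD, one_sub] at h1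
    rw [hDdef] at h1
    simp only [diagonal_mul_diagonal, ← diagonal_smul] at h1
    have h2 := congrFun (diagonal_injective h1) i
    simp only [Pi.smul_apply, smul_eq_mul] at h2
    rw [hg, h2]
    ring
  have hpsd : ∀ i, 0 ≤ l i * (1 - l i) := by
    intro i
    have h1 := congrArg (fun X => Uᵀ * X * U) h.gram_W₂
    simp only [conj _ (1 - T), conj_sub, Matrix.mul_smul, Matrix.smul_mul, hD, one_sub] at h1
    rw [hDdef, diagonal_mul_diagonal] at h1
    have h2 := congrFun (congrFun h1 i) i
    rw [diagonal_apply_eq, show Uᵀ * (W₂ * W₂ᵀ) * U = (Uᵀ * W₂) * (Uᵀ * W₂)ᵀ by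
      simp only [transpose_mul, transpose_transpose, Matrix.mul_assoc]] at h2
    rw [← h2, Matrix.smul_apply, smul_eq_mul, Matrix.mul_apply]
    simp only [transpose_apply]
    exact mul_nonneg (by positivity) (Finset.sum_nonneg fun j _ => mul_self_nonneg _)
  -- An eigenvalue 1 would turn the polynomial equation into g = 0.
  have hlt : ∀ i, l i < 1 := by
    intro i
    by_contra! hi
    have h1 : l i = 1 := by nlinarith [hpsd i]
    have h2 := hcubic i
    rw [h1] at h2
    norm_num at h2
    exact hg0.ne' h2
  have hnn : ∀ i, 0 ≤ l i := fun i => by nlinarith [hpsd i, hlt i]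
  -- the values of the objective
  set φ : ℝ → ℝ := fun t => 1 + t - 2 * t ^ 2 with hφ
  have hval : objective a₂ a₁ b W₂ W₁ (repeatCols n H) = 1 / (2 * K) * ∑ i, φ (l i) := by
    rw [h.objective_eq hK hn]
    congr 1
    have h1 : ∀ A : Matrix (Fin K) (Fin K) ℝ, A.trace = (Uᵀ * A * U).trace := by
      intro A
      rw [Matrix.mul_assoc, trace_mul_comm, Matrix.mul_assoc, hU', Matrix.mul_one]
    rw [trace_sub, trace_add, trace_smul, h1 T, h1 (T * T), conj, hD, hDdef,
      diagonal_mul_diagonal, trace_diagonal, trace_diagonal, trace_one]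
    simp only [hφ, Finset.sum_sub_distrib, Finset.sum_add_distrib, ← Finset.mul_sum, sq]
    simp
  have hzero : ∑ i, φ (l i) ≤ K * 1 := by
    have h1 := hmin 0 0 0
    rw [hval, objective_zero hK hn] at h1
    field_simp at h1
    linarith
  have hcomp : ∀ j, ∑ i, φ (l i) ≤ K * φ (l j) := by
    intro j
    rcases (hnn j).eq_or_lt with h0 | h0
    · rw [← h0]
      simpa [hφ] using hzero
    have hl1 : 0 < 1 - l j := sub_pos.2 (hlt j)
    have hs : 0 < l j * (1 - l j) := mul_pos h0 hl1
    have hcub : g = l j * (1 - l j) ^ 3 := by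
      apply mul_right_cancel₀ h0.ne'
      rw [hcubic j]; ring
    -- The scalars equalize the penalties, as at a stationary point; by the polynomial equation
    -- their product is `l j`.
    obtain ⟨V₂, V₁, G, hV⟩ := exists_objective_eq hK hn hd a₂ a₁ b
      (√(l j * (1 - l j) / (K * a₂))) (√(l j * (1 - l j) / (K * a₁)))
      (√(l j * (1 - l j) / (K * n * b)))
    have h1 := hmin V₂ V₁ G
    have hxyz : √(l j * (1 - l j) / (K * a₂)) * √(l j * (1 - l j) / (K * a₁))
        * √(l j * (1 - l j) / (K * n * b)) = l j := by
      rw [← Real.sqrt_mul (by positivity), ← Real.sqrt_mul (by positivity)]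
      rw [show l j * (1 - l j) / (K * a₂) * (l j * (1 - l j) / (K * a₁))
        * (l j * (1 - l j) / (K * n * b)) = (l j * (1 - l j)) ^ 3 / g by rw [hg]; field_simp,
        hcub, show (l j * (1 - l j)) ^ 3 / (l j * (1 - l j) ^ 3) = l j ^ 2 by field_simp,
        Real.sqrt_sq h0.le]
    rw [hV, hval, hxyz, Real.sq_sqrt (by positivity), Real.sq_sqrt (by positivity),
      Real.sq_sqrt (by positivity)] at h1
    have h2 : 1 / 2 * (l j - 1) ^ 2 + K * (a₂ * (l j * (1 - l j) / (K * a₂))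
        + a₁ * (l j * (1 - l j) / (K * a₁)) + b * n * (l j * (1 - l j) / (K * n * b))) / 2
        = φ (l j) / 2 := by
      simp only [hφ]
      field_simp
      ring
    rw [h2] at h1
    field_simp at h1
    linarith
  -- No value of φ lies below the average, so all equal it.
  have hconst : ∀ j, K * φ (l j) = ∑ i, φ (l i) := by
    intro j
    have h1 : ∑ i, (K * φ (l i) - ∑ i', φ (l i')) = 0 := by
      rw [Finset.sum_sub_distrib, ← Finset.mul_sum]
      simp
    have h2 := (Finset.sum_eq_zero_iff_of_nonneg fun i _ => sub_nonneg.2 (hcomp i)).1 h1 j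
      (Finset.mem_univ j)
    linarith
  have hhalf : ∀ j, l j ≠ 0 → 1 / 2 ≤ l j ∧ l j * (1 - l j) ^ 3 = g := by
    intro j hj
    have h0 : 0 < l j := lt_of_le_of_ne (hnn j) (Ne.symm hj)
    constructor
    -- φ(t) ≤ 1 reads t(1 - 2t) ≤ 0.
    · have h1 : K * φ (l j) ≤ K * 1 := (hconst j).trans_le hzero
      have h2 := le_of_mul_le_mul_left h1 hK'
      simp only [hφ] at h2
      nlinarith
    · apply mul_right_cancel₀ hj
      rw [hcubic j]; ring
  by_cases hall : ∀ j, l j = 0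
  · have hT : T = 0 := by
      apply conj_inj
      rw [hD, hDdef, funext hall, Matrix.mul_zero, Matrix.zero_mul]
      exact diagonal_zero
    -- For T = 0 any τ in (0, 1) serves.
    exact ⟨1 / 2, by norm_num, by norm_num, by simp [hT], fun hne => absurd hT hne⟩
  push Not at hall
  obtain ⟨k, hk⟩ := hall
  have hval_eq : ∀ j, l j ≠ 0 → l j = l k := fun j hj =>
    eq_of_mul_one_sub_cube_eq (hhalf j hj).1 (hlt j) (hhalf k hk).1 (hlt k)
      ((hhalf j hj).2.trans (hhalf k hk).2.symm)
  refine ⟨l k, by linarith [(hhalf k hk).1], hlt k, ?_, fun _ hor => ?_⟩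
  · apply conj_inj
    rw [conj, Matrix.mul_smul, Matrix.smul_mul, hD, hDdef, diagonal_mul_diagonal, ← diagonal_smul]
    congr 1
    ext j
    by_cases hj : l j = 0
    · simp [hj]
    · simp [hval_eq j hj]
  · have hne : ∀ j, l j ≠ 0 := by
      rcases hor with rfl | hnot
      · intro j
        rwa [Subsingleton.elim j k]
      -- A zero eigenvalue makes the average of φ equal to φ(0) = 1, so the minimum is 1/2, the loss
      -- of the zero triple.
      · intro j hj
        apply hnot
        intro V₂ V₁ G
        refine le_trans (le_of_eq ?_) (hmin V₂ V₁ G)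
        rw [objective_zero hK hn, hval, ← hconst j, hj]
        simp only [hφ]
        field_simp
        ring
    apply conj_inj
    rw [hD, hDdef, Matrix.mul_smul, Matrix.smul_mul, Matrix.mul_one, hU, smul_one_eq_diagonal]
    congr 1
    ext j
    exact hval_eq j (hne j)

end ExtendedUFM

theorem theorem3 (K n d : ℕ) (hK : 1 ≤ K) (hn : 1 ≤ n) (hd : K < d)
    (lamW₂ lamW₁ lamH₁ : ℝ) (hW₂ : 0 < lamW₂) (hW₁ : 0 < lamW₁) (hH₁ : 0 < lamH₁)
    (W₂ : Matrix (Fin K) (Fin d) ℝ) (W₁ : Matrix (Fin d) (Fin d) ℝ)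
    (H₁ : Matrix (Fin d) (Fin K × Fin n) ℝ)
    (hmin : IsGlobalMinimizer lamW₂ lamW₁ lamH₁ W₂ W₁ H₁) :
    ∃ Hbar₁ Hbar₂ : Matrix (Fin d) (Fin K) ℝ,
      H₁ = repeatCols n Hbar₁ ∧ W₁ * H₁ = repeatCols n Hbar₂ ∧
      -- alignment of the weights with the two levels of features
      Proportional (W₂ * W₁)ᵀ Hbar₁ ∧
      Proportional W₂ᵀ Hbar₂ ∧
      Proportional ((W₂ * W₁) * Hbar₁) (Hbar₁ᵀ * Hbar₁) ∧
      Proportional (Hbar₁ᵀ * Hbar₁) ((W₂ * W₁) * (W₂ * W₁)ᵀ) ∧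
      Proportional (W₂ * Hbar₂) (Hbar₂ᵀ * Hbar₂) ∧
      Proportional (Hbar₂ᵀ * Hbar₂) (W₂ * W₂ᵀ) ∧
      -- orthogonality, for a nonzero minimizer, without a tie with the zero solution
      (¬ (W₂ = 0 ∧ W₁ = 0 ∧ H₁ = 0) →
        (K = 1 ∨ ¬ IsGlobalMinimizer lamW₂ lamW₁ lamH₁
          (0 : Matrix (Fin K) (Fin d) ℝ) (0 : Matrix (Fin d) (Fin d) ℝ)
          (0 : Matrix (Fin d) (Fin K × Fin n) ℝ)) →
        Proportional ((W₂ * W₁) * Hbar₁) (1 : Matrix (Fin K) (Fin K) ℝ) ∧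
        Proportional (Hbar₁ᵀ * Hbar₁) (1 : Matrix (Fin K) (Fin K) ℝ) ∧
        Proportional ((W₂ * W₁) * (W₂ * W₁)ᵀ) (1 : Matrix (Fin K) (Fin K) ℝ) ∧
        Proportional (W₂ * Hbar₂) (1 : Matrix (Fin K) (Fin K) ℝ) ∧
        Proportional (Hbar₂ᵀ * Hbar₂) (1 : Matrix (Fin K) (Fin K) ℝ) ∧
        Proportional (W₂ * W₂ᵀ) (1 : Matrix (Fin K) (Fin K) ℝ)) := by
  obtain ⟨H, T, rfl, hstat⟩ := hmin.exists_stationary hK hn hH₁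
  have hK' : (0 : ℝ) < K := by exact_mod_cast hK
  have hn' : (0 : ℝ) < n := by exact_mod_cast hn
  have hα : 0 < K * lamW₂ := by positivity
  have hβ : 0 < K * lamW₁ := by positivity
  have hγ : 0 < K * n * lamH₁ := by positivity
  obtain ⟨τ, hτ, hτ', hT, hT'⟩ := hmin.exists_eigenvalue hK hn hd.le hW₂ hW₁ hH₁ hstat
  obtain ⟨hMH, hWH, h1, h2, h3, h4, h5, h6⟩ := hstat.aligned hα hβ hγ hτ hτ' hT
  refine ⟨H, W₁ * H, rfl, mul_repeatCols n W₁ H, hMH, hWH, h1.trans h2.symm, h2.trans h3.symm,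
    h4.trans h5.symm, h5.trans h6.symm, fun hne hor => ?_⟩
  have hT0 : T ≠ 0 := by
    intro h0
    obtain ⟨hz₂, hz₁, hz⟩ := hstat.eq_zero_of_output_eq_zero hα hβ hγ h0
    exact hne ⟨hz₂, hz₁, by rw [hz]; rfl⟩
  have hone : Proportional T (1 : Matrix (Fin K) (Fin K) ℝ) := ⟨τ, hτ, hT' hT0 hor⟩
  exact ⟨h1.trans hone, h2.trans hone, h3.trans hone, h4.trans hone, h5.trans hone,
    h6.trans hone⟩
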